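/- Let $n\ge 2$, $a<b$, and let $\Theta=(\theta_1,\dots,\theta_{n+2})$ be a knot vector with $a=\theta_1=\theta_2<\theta_3<\cdots<\theta_n<\theta_{n+1}=\theta_{n+2}=b$ (double knots at the endpoints, simple interior knots $\theta_3,\dots,\theta_n$, which may be absent). For $m\in\{2,4\}$ let $$N_{m,k}(x)=(\theta_{k+m}-\theta_k)\,[\theta_k,\dots,\theta_{k+m}\mid(\cdot-x)_+^{m-1}],\qquad 1\le k\le n+2-m,$$ be the normalized B-splines of order $m$ on $\Theta$, regarded as continuous functions on $[a,b]$, and let $\Phi_2=(N_{2,1},\dots,N_{2,n})$. Put $h_{j,k}=(\theta_{k+j}-\theta_k)/j$ and let $D_2\in\mathbb R^{(n-1)\times n}$ and $D_3\in\mathbb R^{(n-2)\times(n-1)}$ be $$D_q=\begin{bmatrix}1&-1\\&1&-1\\&&\ddots&\ddots\\&&&1&-1\end{bmatrix}\operatorname{diag}\bigl(h_{q,1}^{-1},\dots,h_{q,n+2-q}^{-1}\bigr),\qquad q=2,3.$$ Let $\Gamma=\int_a^b\Phi_2(x)^T\Phi_2(x)\,dx\in\mathbb R^{n\times n}$ be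 the Gram matrix of $\Phi_2$, let $$S=\operatorname{diag}\Bigl(\tfrac{2}{\theta_{k+2}-\theta_k}\Bigr)_{1\le k\le n}+D_2^T\operatorname{diag}\Bigl(\tfrac{(\theta_{k+2}-\theta_{k+1})^2}{2(\theta_{k+3}-\theta_k)}\Bigr)_{1\le k\le n-1}D_2,$$ and for $U_2\in\mathbb R^{(n-2)\times(n-2)}$ let $$L(x,y)=\Phi_2(y)\,S_L\,\Phi_2(x)^T,\qquad S_L=S+D_2^TD_3^T\,U_2\,D_3D_2 .$$ Then the following hold. (a) $I_n-\Gamma S=ZD_3D_2$, where $Z\in\mathbb R^{n\times(n-2)}$ is the lower triangular matrix with entries, for $1\le j\le n-2$, $$z_{j,j}=\frac{(\theta_{j+2}-\theta_{j+1})(\theta_{j+3}-\theta_{j+2})^2}{18(\theta_{j+3}-\theta_{j+1})},\quad z_{j+1,j}=-\frac{(\theta_{j+2}-\theta_{j+1})(\theta_{j+3}-\theta_{j+2})}{18},\quad z_{j+2,j}=\frac{(\theta_{j+2}-\theta_{j+1})^2(\theta_{j+3}-\theta_{j+2})}{18(\theta_{j+3}-\theta_{j+1})},$$ and all other entries zero.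 (b) Let $3\le\ell_1<\cdots<\ell_r\le n$ be indices of interior knots (with $r\ge 0$), and let $$A=\bigl[N_{4,k}(\theta_{\ell_j})\bigr]_{1\le j\le r,\;1\le k\le n-2},\qquad B=\bigl[\kappa_{\ell_j}e_{\ell_j-2}^T\bigr]_{1\le j\le r}\in\mathbb R^{r\times(n-2)},\qquad \kappa_\ell=\frac{(\theta_\ell-\theta_{\ell-1})^2(\theta_{\ell+1}-\theta_\ell)^2}{18(\theta_{\ell+1}-\theta_{\ell-1})},$$ where $e_k$ is the $k$-th canonical unit vector of $\mathbb R^{n-2}$. For every $U_2\in\mathbb R^{(n-2)\times(n-2)}$ with $AU_2=B$, the kernel $L$ reproduces all polynomials of degree at most $1$ and all truncated powers $x\mapsto(\theta_{\ell_j}-x)_+$, $1\le j\le r$; that is, for each such function $f$ and all $x\in[a,b]$, $$\int_a^b f(y)\,L(x,y)\,dy=f(x).$$ -/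

import Mathlib

noncomputable section

namespace LinearSpline

/-- Knot vectors are written with their usual 1-based indices: only the values
`θ 1, …, θ (n + 2)` of the sequence `θ` are relevant. The predicate says that they form an open
knot vector of order `2` on `[a, b]`: the knots `θ 1 = θ 2 = a` and `θ (n + 1) = θ (n + 2) = b` are
double, and the interior knots `θ 3 < ⋯ < θ n` are simple. -/
structure IsOpenKnotVector (n : ℕ) (θ : ℕ → ℝ) (a b : ℝ) : Prop where
  a_lt_b : a < b
  left_one : θ 1 = a
  left_two : θ 2 = a
  right_one : θ (n + 1) = b
  right_two : θ (n + 2) = b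
  strict : ∀ k, 2 ≤ k → k ≤ n → θ k < θ (k + 1)

/-- The divided difference `[θ k, …, θ (k + j) | f]` of a nondecreasing sequence of nodes, with
derivatives at coalescing nodes. -/
def divDiff (θ : ℕ → ℝ) (f : ℝ → ℝ) : ℕ → ℕ → ℝ
  | 0, k => f (θ k)
  | j + 1, k =>
    if θ k = θ (k + (j + 1)) then iteratedDeriv (j + 1) f (θ k) / ((j + 1).factorial : ℝ)
    else (divDiff θ f j (k + 1) - divDiff θ f j k) / (θ (k + (j + 1)) - θ k)

/-- The normalized B-spline `N_{m,k}` of order `m ≥ 2`, as a continuous function on `[a, b]`: it is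
`(θ (k + m) - θ k) [θ k, …, θ (k + m) | (· - x)_+ ^ (m - 1)]` for `x ∈ (a, b)`, and its values at
the end points are the one-sided limits. -/
def bspline (θ : ℕ → ℝ) (a b : ℝ) (m k : ℕ) : ℝ → ℝ :=
  extendFrom (Set.Ioo a b) fun x =>
    (θ (k + m) - θ k) * divDiff θ (fun t => max (t - x) 0 ^ (m - 1)) m k

/-- The scaled knot span `h_{j,k} = (θ (k + j) - θ k) / j`. -/
def span (θ : ℕ → ℝ) (j k : ℕ) : ℝ := (θ (k + j) - θ k) / j

/-! In all matrices below, the entry with (0-based) indices `i, k` in `Fin` is the entry in row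
`i + 1` and column `k + 1` in the usual 1-based numbering. -/

/-- The difference matrix `D_q`, the product of the bidiagonal matrix with rows
`(0, …, 1, -1, …, 0)` and `diag (h_{q,1}⁻¹, …, h_{q,c}⁻¹)`, of size `r × c` with `c = r + 1`. -/
def diffMatrix (θ : ℕ → ℝ) (q r c : ℕ) : Matrix (Fin r) (Fin c) ℝ :=
  Matrix.of (fun (i : Fin r) (k : Fin c) =>
    if (k : ℕ) = i then (1 : ℝ) else if (k : ℕ) = (i : ℕ) + 1 then -1 else 0) *
  Matrix.diagonal fun k : Fin c => (span θ q ((k : ℕ) + 1))⁻¹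

/-- `D_2`, of size `(n - 1) × n`. -/
def D2 (θ : ℕ → ℝ) (n : ℕ) : Matrix (Fin (n - 1)) (Fin n) ℝ := diffMatrix θ 2 (n - 1) n

/-- `D_3`, of size `(n - 2) × (n - 1)`. -/
def D3 (θ : ℕ → ℝ) (n : ℕ) : Matrix (Fin (n - 2)) (Fin (n - 1)) ℝ :=
  diffMatrix θ 3 (n - 2) (n - 1)

/-- The Gram matrix `Γ` of the B-splines `N_{2,1}, …, N_{2,n}` in `L²(a, b)`. -/
def gram (θ : ℕ → ℝ) (a b : ℝ) (n : ℕ) : Matrix (Fin n) (Fin n) ℝ :=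
  Matrix.of fun i k => ∫ x in a..b, bspline θ a b 2 ((i : ℕ) + 1) x * bspline θ a b 2 ((k : ℕ) + 1) x

/-- The matrix `S = U_0 + D_2ᵀ U_1 D_2` of the approximate duals of order `2`, with
`U_0 = diag (2 / (θ (k + 2) - θ k))` and
`U_1 = diag ((θ (k + 2) - θ (k + 1))² / (2 (θ (k + 3) - θ k)))`. -/
def S (θ : ℕ → ℝ) (n : ℕ) : Matrix (Fin n) (Fin n) ℝ :=
  Matrix.diagonal (fun i : Fin n => 2 / (θ ((i : ℕ) + 1 + 2) - θ ((i : ℕ) + 1))) +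
  (D2 θ n).transpose *
    Matrix.diagonal (fun i : Fin (n - 1) =>
      (θ ((i : ℕ) + 1 + 2) - θ ((i : ℕ) + 1 + 1)) ^ 2 / (2 * (θ ((i : ℕ) + 1 + 3) - θ ((i : ℕ) + 1)))) *
    D2 θ n

/-- `S_L = S + D_2ᵀ D_3ᵀ U D_3 D_2`. -/
def SL (θ : ℕ → ℝ) (n : ℕ) (U : Matrix (Fin (n - 2)) (Fin (n - 2)) ℝ) :
    Matrix (Fin n) (Fin n) ℝ :=
  S θ n + (D2 θ n).transpose * (D3 θ n).transpose * U * D3 θ n * D2 θ n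

/-- The kernel `L(x, y) = Φ_2(y) S_L Φ_2(x)ᵀ`, where `Φ_2 = (N_{2,1}, …, N_{2,n})`. -/
def kernelL (θ : ℕ → ℝ) (a b : ℝ) (n : ℕ) (U : Matrix (Fin (n - 2)) (Fin (n - 2)) ℝ)
    (x y : ℝ) : ℝ :=
  ∑ i : Fin n, ∑ k : Fin n,
    bspline θ a b 2 ((i : ℕ) + 1) y * SL θ n U i k * bspline θ a b 2 ((k : ℕ) + 1) x

/-- The integral operator with kernel `L` on `[a, b]` reproduces `f`. -/
def Reproduces (a b : ℝ) (L : ℝ → ℝ → ℝ) (f : ℝ → ℝ) : Prop :=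
  ∀ x ∈ Set.Icc a b,
    IntervalIntegrable (fun y => f y * L x y) MeasureTheory.volume a b ∧
      ∫ y in a..b, f y * L x y = f x

/-- The lower triangular `n × (n - 2)` matrix `Z`, with three nonzero diagonals. -/
def Z (θ : ℕ → ℝ) (n : ℕ) : Matrix (Fin n) (Fin (n - 2)) ℝ :=
  Matrix.of fun i k =>
    let j : ℕ := k + 1
    if (i : ℕ) + 1 = j then
      (θ (j + 2) - θ (j + 1)) * (θ (j + 3) - θ (j + 2)) ^ 2 / (18 * (θ (j + 3) - θ (j + 1)))
    else if (i : ℕ) + 1 = j + 1 then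
      -((θ (j + 2) - θ (j + 1)) * (θ (j + 3) - θ (j + 2)) / 18)
    else if (i : ℕ) + 1 = j + 2 then
      (θ (j + 2) - θ (j + 1)) ^ 2 * (θ (j + 3) - θ (j + 2)) / (18 * (θ (j + 3) - θ (j + 1)))
    else 0

/-- The number `κ_ℓ`, for `ℓ ≥ 1`. -/
def kappa (θ : ℕ → ℝ) (l : ℕ) : ℝ :=
  (θ l - θ (l - 1)) ^ 2 * (θ (l + 1) - θ l) ^ 2 / (18 * (θ (l + 1) - θ (l - 1)))

/-- The collocation matrix `A = [N_{4,k}(θ_{ℓ_j})]`, of size `r × (n - 2)`. -/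
def collocA (θ : ℕ → ℝ) (a b : ℝ) (n : ℕ) {r : ℕ} (l : Fin r → ℕ) :
    Matrix (Fin r) (Fin (n - 2)) ℝ :=
  Matrix.of fun j k => bspline θ a b 4 ((k : ℕ) + 1) (θ (l j))

/-- The matrix `B` with rows `κ_{ℓ_j} e_{ℓ_j - 2}ᵀ`, of size `r × (n - 2)`. -/
def rhsB (θ : ℕ → ℝ) (n : ℕ) {r : ℕ} (l : Fin r → ℕ) : Matrix (Fin r) (Fin (n - 2)) ℝ :=
  Matrix.of fun j k => if (k : ℕ) + 1 = l j - 2 then kappa θ (l j) else 0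

end LinearSpline

end

noncomputable section

namespace LinearSpline

open Set Filter Topology MeasureTheory

open scoped Matrix

variable {n : ℕ} {θ : ℕ → ℝ} {a b : ℝ}

/-! Write `C` for the bidiagonal difference matrix, `H = diag(h_{2,k})`, so `D2 = C H⁻¹` and the
diagonal part of `S` is `H⁻¹`. Integrating hat functions gives `Γ = H - Cᵀ W C` with `W` diagonal
(`gram_eq`), hence `1 - Γ S = Cᵀ (W + (W D2 Cᵀ - 1) U₁) D2`. The bracket is tridiagonal and factors
as a bidiagonal matrix times `D3` (`diagonal_add_eq_ZFactor_mul_D3`); multiplying that factor by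
`Cᵀ` yields `Z`. This is (a).

For (b), let `f` be a linear spline with knot values `c`. By (a), `L` reproduces `f` as soon as `c Z
= (c Γ D2ᵀ D3ᵀ) U` (`reproduces_of_vecMul`). Both sides detect the kinks of `f`. The entries of `c
Z` are the slope jumps times `κ` (`vecMul_Z`). Since `Φ₂ D2ᵀ D3ᵀ` lists the second derivatives of
the cubic B-splines, `c Γ D2ᵀ D3ᵀ` consists of scaled fourth divided differences of a `G` with `G''
= 6 f` (`vecMul_gram_mul_transpose`). For `f` linear both vanish; for `f = (· - θ_ℓ)_+` they are a
row of `B` and a row of `A`, so `A U = B` is exactly what is needed. -/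

theorem divDiff_one (θ : ℕ → ℝ) (f : ℝ → ℝ) (k : ℕ) :
    divDiff θ f 1 k = if θ k = θ (k + 1) then deriv f (θ k)
      else (f (θ (k + 1)) - f (θ k)) / (θ (k + 1) - θ k) := by
  simp [divDiff, iteratedDeriv_one]

/-! ### Order and multiplicity of the knots. -/

namespace IsOpenKnotVector

theorem two_le (hθ : IsOpenKnotVector n θ a b) : 2 ≤ n := by
  obtain ⟨h, h1, h2, h3, h4, -⟩ := hθ
  by_contra hn
  have : n = 0 ∨ n = 1 := by omega
  rcases this with rfl | rfl
  · simp only [zero_add] at h3; linarith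
  · simp only [Nat.reduceAdd] at h3; linarith

theorem lt_of_lt (hθ : IsOpenKnotVector n θ a b) {i j : ℕ} (hi : 2 ≤ i) (hij : i < j)
    (hj : j ≤ n + 1) : θ i < θ j := by
  induction j, hij using Nat.le_induction with
  | base => exact hθ.strict i hi (by omega)
  | succ m hm ih => exact (ih (by omega)).trans (hθ.strict m (by omega) (by omega))

theorem le_of_le (hθ : IsOpenKnotVector n θ a b) {i j : ℕ} (hi : 1 ≤ i) (hij : i ≤ j)
    (hj : j ≤ n + 2) : θ i ≤ θ j := by
  induction j, hij using Nat.le_induction with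
  | base => exact le_rfl
  | succ m hm ih =>
    refine (ih (by omega)).trans ?_
    rcases (by omega : m = 1 ∨ m = n + 1 ∨ (2 ≤ m ∧ m ≤ n)) with rfl | rfl | h
    · exact (hθ.left_one.trans hθ.left_two.symm).le
    · exact (hθ.right_one.trans hθ.right_two.symm).le
    · exact (hθ.strict m h.1 h.2).le

theorem lt_add (hθ : IsOpenKnotVector n θ a b) {k s : ℕ} (hk : 1 ≤ k) (hs : 2 ≤ s)
    (hks : k + s ≤ n + 2) : θ k < θ (k + s) := by
  have hn := hθ.two_le
  by_cases h1 : k = 1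
  · exact (hθ.le_of_le hk (by omega) (by omega)).trans_lt <|
      (hθ.lt_of_lt (i := 2) (j := 3) (by omega) (by omega) (by omega)).trans_le <|
      hθ.le_of_le (by omega) (by omega) hks
  · exact (hθ.lt_of_lt (i := k) (j := k + 1) (by omega) (by omega) (by omega)).trans_le <|
      hθ.le_of_le (by omega) (by omega) hks

theorem mem_Icc (hθ : IsOpenKnotVector n θ a b) {k : ℕ} (hk : 1 ≤ k) (hk' : k ≤ n + 2) :
    θ k ∈ Icc a b :=
  ⟨hθ.left_one ▸ hθ.le_of_le le_rfl hk hk', hθ.right_two ▸ hθ.le_of_le hk hk' le_rfl⟩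

theorem mem_Ioo (hθ : IsOpenKnotVector n θ a b) {k : ℕ} (hk : 3 ≤ k) (hk' : k ≤ n) :
    θ k ∈ Ioo a b :=
  ⟨hθ.left_two ▸ hθ.lt_of_lt le_rfl (by omega) (by omega),
    hθ.right_one ▸ hθ.lt_of_lt (by omega) (by omega) le_rfl⟩

/-- Consecutive knots coalesce only at the end points. -/
theorem endpoint_or_lt (hθ : IsOpenKnotVector n θ a b) {k : ℕ} (hk : 1 ≤ k) (hk' : k ≤ n + 1) :
    (k = 1 ∧ θ k = a ∧ θ (k + 1) = a) ∨ (k = n + 1 ∧ θ k = b ∧ θ (k + 1) = b) ∨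
      (2 ≤ k ∧ k ≤ n ∧ θ k < θ (k + 1)) := by
  rcases (by omega : k = 1 ∨ k = n + 1 ∨ (2 ≤ k ∧ k ≤ n)) with rfl | rfl | h
  · exact Or.inl ⟨rfl, hθ.left_one, hθ.left_two⟩
  · exact Or.inr (Or.inl ⟨rfl, hθ.right_one, hθ.right_two⟩)
  · exact Or.inr (Or.inr ⟨h.1, h.2, hθ.strict k h.1 h.2⟩)

theorem exists_mem_Icc (hθ : IsOpenKnotVector n θ a b) {x : ℝ} (hx : x ∈ Icc a b) :
    ∃ j, 2 ≤ j ∧ j ≤ n ∧ x ∈ Icc (θ j) (θ (j + 1)) := by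
  have hn := hθ.two_le
  suffices H : ∀ m, 2 ≤ m → m ≤ n → x ≤ θ (m + 1) →
      ∃ j, 2 ≤ j ∧ j ≤ n ∧ x ∈ Icc (θ j) (θ (j + 1)) from
    H n hn le_rfl (hθ.right_one ▸ hx.2)
  intro m hm
  induction m, hm using Nat.le_induction with
  | base => exact fun _ h => ⟨2, le_rfl, hn, hθ.left_two ▸ hx.1, h⟩
  | succ m hm ih =>
    intro hmn h
    rcases le_total x (θ (m + 1)) with h' | h'
    · exact ih (by omega) h'
    · exact ⟨m + 1, by omega, hmn, h', h⟩

/-- No knot has multiplicity above two, so only first-order differences can be confluent. -/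
theorem divDiff_add_two (hθ : IsOpenKnotVector n θ a b) (f : ℝ → ℝ) {j k : ℕ} (hk : 1 ≤ k)
    (hkj : k + (j + 2) ≤ n + 2) :
    divDiff θ f (j + 2) k =
      (divDiff θ f (j + 1) (k + 1) - divDiff θ f (j + 1) k) / (θ (k + (j + 2)) - θ k) := by
  rw [divDiff, if_neg (hθ.lt_add hk (by omega) hkj).ne]

end IsOpenKnotVector

/-! ### Truncated powers and their divided differences. -/

theorem deriv_truncPow_of_lt {x t : ℝ} (h : t < x) {p : ℕ} (hp : p ≠ 0) :
    deriv (fun s => max (s - x) 0 ^ p) t = 0 := by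
  have : (fun s => max (s - x) 0 ^ p) =ᶠ[𝓝 t] fun _ => 0 := by
    filter_upwards [gt_mem_nhds h] with s hs
    rw [max_eq_right (by linarith), zero_pow hp]
  rw [this.deriv_eq, deriv_const]

theorem deriv_truncPow_of_gt {x t : ℝ} (h : x < t) (p : ℕ) :
    deriv (fun s => max (s - x) 0 ^ p) t = p * (t - x) ^ (p - 1) := by
  have : (fun s => max (s - x) 0 ^ p) =ᶠ[𝓝 t] fun s => (s - x) ^ p := by
    filter_upwards [lt_mem_nhds h] with s hs
    rw [max_eq_left (by linarith)]
  rw [this.deriv_eq]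
  simp

theorem deriv_truncCube (x t : ℝ) :
    deriv (fun s => max (s - x) 0 ^ 3) t = 3 * max (t - x) 0 ^ 2 := by
  rcases lt_trichotomy t x with h | rfl | h
  · rw [deriv_truncPow_of_lt h (by norm_num), max_eq_right (by linarith)]; norm_num
  -- At the kink the function is `O((s - t)^3)`, hence `o(s - t)`.
  · have : HasDerivAt (fun s => max (s - t) 0 ^ 3) 0 t := by
      rw [hasDerivAt_iff_isLittleO]
      have h1 : (fun s : ℝ => max (s - t) 0 ^ 3) =O[𝓝 t] fun s => (s - t) ^ 3 := by
        refine Asymptotics.isBigO_of_le _ fun s => ?_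
        rw [norm_pow, norm_pow]
        refine pow_le_pow_left₀ (norm_nonneg _) ?_ 3
        rw [Real.norm_eq_abs, Real.norm_eq_abs, abs_of_nonneg (le_max_right _ _)]
        exact max_le (le_abs_self _) (abs_nonneg _)
      have h2 : (fun s : ℝ => (s - t) ^ 3) =o[𝓝 t] fun s => s - t := by
        have := (Asymptotics.isLittleO_pow_id (𝕜 := ℝ) (n := 3) (by norm_num)).comp_tendsto
          (show Tendsto (fun s : ℝ => s - t) (𝓝 t) (𝓝 0) from
            ((continuous_id.sub continuous_const).tendsto' t 0 (by simp)))
        exact this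
      simpa using h1.trans_isLittleO h2
    rw [this.deriv]; simp
  · rw [deriv_truncPow_of_gt h, max_eq_left (by linarith)]; norm_num

/-- The divided difference of the truncated power `(· - x)_+ ^ p` over an open knot vector depends
continuously on `x` in the open interval. -/
theorem continuousAt_divDiff_truncPow (hθ : IsOpenKnotVector n θ a b) {p : ℕ} (hp : p ≠ 0)
    {x₀ : ℝ} (hx : x₀ ∈ Ioo a b) (j : ℕ) : ∀ k, 1 ≤ k → k + j ≤ n + 2 →
    ContinuousAt (fun x => divDiff θ (fun t => max (t - x) 0 ^ p) j k) x₀ := by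
  have h0 : ∀ k, ContinuousAt (fun x => max (θ k - x) 0 ^ p) x₀ := fun k => by fun_prop
  induction j with
  | zero => intro k _ _; simpa only [divDiff] using h0 k
  | succ j ih =>
    intro k hk hkj
    rcases j with _ | j
    · simp only [zero_add, divDiff_one]
      -- Derivatives enter only at `a` and `b`; as `x` stays strictly between them, the kink is
      -- never differentiated.
      rcases hθ.endpoint_or_lt hk (by omega) with ⟨-, h1, h2⟩ | ⟨-, h1, h2⟩ | ⟨-, -, h⟩
      · simp only [h1, h2, if_true]
        refine (continuousAt_const (y := (0 : ℝ))).congr ?_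
        filter_upwards [lt_mem_nhds hx.1] with x hx
        exact (deriv_truncPow_of_lt hx hp).symm
      · simp only [h1, h2, if_true]
        refine (show ContinuousAt (fun x : ℝ => (p : ℝ) * (b - x) ^ (p - 1)) x₀ by
          fun_prop).congr ?_
        filter_upwards [gt_mem_nhds hx.2] with x hx
        exact (deriv_truncPow_of_gt hx p).symm
      · simp only [h.ne, if_false]
        exact ((h0 _).sub (h0 _)).div_const _
    · simp only [hθ.divDiff_add_two _ hk hkj]
      exact ((ih (k + 1) (by omega) (by omega)).sub (ih k hk (by omega))).div_const _

theorem bspline_eq_of_mem_Ioo (hθ : IsOpenKnotVector n θ a b) {m k : ℕ} (hm : 2 ≤ m)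
    (hk : 1 ≤ k) (hkm : k + m ≤ n + 2) {x : ℝ} (hx : x ∈ Ioo a b) :
    bspline θ a b m k x =
      (θ (k + m) - θ k) * divDiff θ (fun t => max (t - x) 0 ^ (m - 1)) m k :=
  extendFrom_eq (subset_closure hx) <| tendsto_nhdsWithin_of_tendsto_nhds <|
    continuousAt_const.mul <| continuousAt_divDiff_truncPow hθ (by omega) hx m k hk hkm

/-! ### Linear B-splines as hat functions. -/

/-- The first divided difference of `(· - x)_+` at `θ k, θ (k + 1)`, continued from `x ∈ (a, b)`
to all of `ℝ`. -/
def ramp (θ : ℕ → ℝ) (n k : ℕ) (x : ℝ) : ℝ :=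
  if k = 1 then 0 else if k = n + 1 then 1
    else (max (θ (k + 1) - x) 0 - max (θ k - x) 0) / (θ (k + 1) - θ k)

theorem continuous_ramp (θ : ℕ → ℝ) (n k : ℕ) : Continuous (ramp θ n k) := by
  unfold ramp
  split_ifs
  · exact continuous_const
  · exact continuous_const
  · fun_prop

theorem divDiff_eq_ramp (hθ : IsOpenKnotVector n θ a b) {k : ℕ} (hk : 1 ≤ k) (hk' : k ≤ n + 1)
    {x : ℝ} (hx : x ∈ Ioo a b) :
    divDiff θ (fun t => max (t - x) 0 ^ 1) 1 k = ramp θ n k x := by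
  have hn := hθ.two_le
  rw [divDiff_one, ramp]
  rcases hθ.endpoint_or_lt hk hk' with ⟨h, h1, h2⟩ | ⟨h, h1, h2⟩ | ⟨h1, h2, h⟩
  · rw [if_pos (h1.trans h2.symm), if_pos h, h1, deriv_truncPow_of_lt hx.1 one_ne_zero]
  · rw [if_pos (h1.trans h2.symm), if_neg (by omega), if_pos h, h1, deriv_truncPow_of_gt hx.2]
    simp
  · rw [if_neg h.ne, if_neg (by omega), if_neg (by omega), pow_one, pow_one]

theorem bspline_two_eq_ramp (hθ : IsOpenKnotVector n θ a b) {k : ℕ} (hk : 1 ≤ k) (hk' : k ≤ n)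
    {x : ℝ} (hx : x ∈ Icc a b) :
    bspline θ a b 2 k x = ramp θ n (k + 1) x - ramp θ n k x := by
  refine extendFrom_eq ((closure_Ioo hθ.a_lt_b.ne).symm ▸ hx) ?_
  refine Tendsto.congr' ?_ (tendsto_nhdsWithin_of_tendsto_nhds
    ((continuous_ramp θ n (k + 1)).sub (continuous_ramp θ n k)).continuousAt)
  filter_upwards [self_mem_nhdsWithin] with y hy
  rw [hθ.divDiff_add_two _ (j := 0) hk (by omega), zero_add]
  simp only [Nat.add_one_sub_one]
  rw [divDiff_eq_ramp hθ hk (by omega) hy, divDiff_eq_ramp hθ (by omega) (by omega) hy,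
    mul_div_cancel₀ _ (sub_pos.2 (hθ.lt_add hk le_rfl (by omega))).ne', Pi.sub_apply]

theorem continuousOn_bspline_two (hθ : IsOpenKnotVector n θ a b) {k : ℕ} (hk : 1 ≤ k)
    (hk' : k ≤ n) : ContinuousOn (bspline θ a b 2 k) (Icc a b) :=
  ((continuous_ramp θ n (k + 1)).sub (continuous_ramp θ n k)).continuousOn.congr
    fun _ hx => bspline_two_eq_ramp hθ hk hk' hx

/-- The linear B-splines are the hat functions. -/
theorem bspline_two_eq (hθ : IsOpenKnotVector n θ a b) {k : ℕ} (hk : 1 ≤ k) (hk' : k ≤ n)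
    {j : ℕ} (hj : 2 ≤ j) (hj' : j ≤ n) {x : ℝ} (hx : x ∈ Icc (θ j) (θ (j + 1))) :
    bspline θ a b 2 k x =
      (if k + 1 = j then 1 else 0) * ((θ (j + 1) - x) / (θ (j + 1) - θ j)) +
      (if k = j then 1 else 0) * ((x - θ j) / (θ (j + 1) - θ j)) := by
  have hd := sub_pos.2 (hθ.strict j hj hj')
  have hxI : x ∈ Icc a b := ⟨(hθ.mem_Icc (by omega) (by omega)).1.trans hx.1,
    hx.2.trans (hθ.mem_Icc (by omega) (by omega)).2⟩
  -- Each ramp descends from 1 to 0 across its own knot interval, so on the `j`-th interval only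
  -- `ramp θ n j` is not constant.
  have hlt : ∀ m, 1 ≤ m → m < j → ramp θ n m x = 0 := fun m hm hmj => by
    have h1 : θ (m + 1) ≤ x := (hθ.le_of_le (by omega) (by omega) (by omega)).trans hx.1
    have h2 : θ m ≤ x := (hθ.le_of_le hm (by omega) (by omega)).trans h1
    rw [ramp]
    split_ifs with h3 h4
    · rfl
    · omega
    · rw [max_eq_right (by linarith), max_eq_right (by linarith)]; simp
  have hgt : ∀ m, j < m → m ≤ n + 1 → ramp θ n m x = 1 := fun m hm hmj => by
    have h2 : x ≤ θ m := hx.2.trans (hθ.le_of_le (by omega) (by omega) (by omega))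
    have h1 : θ m ≤ θ (m + 1) := hθ.le_of_le (by omega) (by omega) (by omega)
    rw [ramp]
    split_ifs with h3 h4
    · omega
    · rfl
    · have := hθ.strict m (by omega) (by omega)
      rw [max_eq_left (by linarith), max_eq_left (by linarith), div_eq_one_iff_eq] <;> linarith
  have heq : ramp θ n j x = (θ (j + 1) - x) / (θ (j + 1) - θ j) := by
    rw [ramp, if_neg (by omega), if_neg (by omega), max_eq_left (by linarith [hx.2]),
      max_eq_right (by linarith [hx.1]), sub_zero]
  rw [bspline_two_eq_ramp hθ hk hk' hxI]
  rcases (by omega : k + 1 < j ∨ k + 1 = j ∨ k = j ∨ j < k) with h | h | h | h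
  · rw [hlt _ hk (by omega), hlt _ (by omega) h, if_neg (by omega), if_neg (by omega)]; simp
  · rw [hlt _ hk (by omega), h, heq, if_pos rfl, if_neg (by omega)]; simp
  · subst h
    rw [hgt _ (by omega) (by omega), heq, if_neg (by omega), if_pos rfl]
    field_simp
    ring
  · rw [hgt _ (by omega) (by omega), hgt _ h (by omega), if_neg (by omega), if_neg (by omega)]
    simp

/-! ### Sums against bidiagonal matrices. -/

/-- The entries of the bidiagonal difference matrix. -/
def diffEntry (i k : ℕ) : ℝ := if k = i then 1 else if k = i + 1 then -1 else 0

/-- The bidiagonal matrix with rows `(0, …, 1, -1, …, 0)`. -/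
def diffCore (r c : ℕ) : Matrix (Fin r) (Fin c) ℝ :=
  Matrix.of fun (i : Fin r) (k : Fin c) => diffEntry i k

theorem diffMatrix_eq (θ : ℕ → ℝ) (q r c : ℕ) : diffMatrix θ q r c =
    diffCore r c * Matrix.diagonal fun k : Fin c => (span θ q ((k : ℕ) + 1))⁻¹ := rfl

theorem sum_fin_ite_eq (c i : ℕ) (f : ℕ → ℝ) :
    ∑ k : Fin c, (if (k : ℕ) = i then f k else 0) = if i < c then f i else 0 := by
  rw [Fin.sum_univ_eq_sum_range (fun k => if k = i then f k else 0) c]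
  simp [Finset.sum_ite_eq']

theorem diffEntry_eq_sub (i k : ℕ) :
    diffEntry i k = (if k = i then 1 else 0) - (if k = i + 1 then 1 else 0) := by
  unfold diffEntry
  split_ifs <;> first | omega | norm_num

theorem sum_diffEntry_mul {c i : ℕ} (hi : i + 1 < c) (v : ℕ → ℝ) :
    ∑ k : Fin c, diffEntry i k * v k = v i - v (i + 1) := by
  simp only [diffEntry_eq_sub, sub_mul, ite_mul, one_mul, zero_mul, Finset.sum_sub_distrib,
    sum_fin_ite_eq]
  rw [if_pos (by omega), if_pos hi]

/-- Sums along a column of a lower bidiagonal matrix, whose entries continued beyond the matrix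
vanish. -/
theorem sum_lowerBidiagonal_mul {c j : ℕ} (hj : j ≤ c) (p q v : ℕ → ℝ) (hp : p c = 0) :
    ∑ m : Fin c, ((if (m : ℕ) = j then p m else 0) - (if (m : ℕ) + 1 = j then q m else 0)) * v m =
      p j * v j - if j = 0 then 0 else q (j - 1) * v (j - 1) := by
  simp only [sub_mul, ite_mul, zero_mul, Finset.sum_sub_distrib]
  rw [sum_fin_ite_eq c j fun m => p m * v m]
  congr 1
  · split_ifs with h
    · rfl
    -- The last row `j = c` has no diagonal entry; `hp` makes the uniform formula valid there too.
    · rw [show j = c by omega, hp, zero_mul]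
  · rcases j with _ | j
    · simp
    · simp only [Nat.add_right_cancel_iff, Nat.add_one_sub_one, Nat.succ_ne_zero, if_false]
      rw [sum_fin_ite_eq c j fun m => q m * v m, if_pos (by omega)]

/-! ### The Gram matrix. -/

theorem integral_hat_mul_hat {l r : ℝ} (h : l < r) (α β γ δ : ℝ) :
    ∫ x in l..r, (α * ((r - x) / (r - l)) + β * ((x - l) / (r - l))) *
      (γ * ((r - x) / (r - l)) + δ * ((x - l) / (r - l))) =
      (r - l) / 6 * (2 * α * γ + α * δ + β * γ + 2 * β * δ) := by
  have hd : r - l ≠ 0 := (sub_pos.2 h).ne'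
  -- The mixed term is integrated via `(r - x)(x - l) = (r - l)(x - l) - (x - l)^2`.
  have key : ∀ x ∈ uIcc l r, HasDerivAt (fun x => (1 / (r - l) ^ 2) *
      (-(α * γ) * (r - x) ^ 3 / 3 + β * δ * (x - l) ^ 3 / 3 +
        (α * δ + β * γ) * ((r - l) * (x - l) ^ 2 / 2 - (x - l) ^ 3 / 3)))
      ((α * ((r - x) / (r - l)) + β * ((x - l) / (r - l))) *
      (γ * ((r - x) / (r - l)) + δ * ((x - l) / (r - l)))) x := fun x _ => by
    have h1 : HasDerivAt (fun x => r - x) (-1) x := by simpa using (hasDerivAt_id x).const_sub r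
    have h2 : HasDerivAt (fun x => x - l) 1 x := by simpa using (hasDerivAt_id x).sub_const l
    have := (((((h1.pow 3).const_mul (-(α * γ))).div_const 3).add
      (((h2.pow 3).const_mul (β * δ)).div_const 3)).add
      (((((h2.pow 2).const_mul (r - l)).div_const 2).sub ((h2.pow 3).div_const 3)).const_mul
        (α * δ + β * γ))).const_mul (1 / (r - l) ^ 2)
    refine HasDerivAt.congr_deriv this ?_
    push_cast
    field_simp
    ring
  rw [intervalIntegral.integral_eq_sub_of_hasDerivAt key
    (Continuous.intervalIntegrable (by fun_prop) _ _)]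
  field_simp
  ring

theorem intervalIntegrable_bspline_two_mul (hθ : IsOpenKnotVector n θ a b) {i k : ℕ} (hi : i < n)
    (hk : k < n) {s t : ℝ} (hs : s ∈ Icc a b) (ht : t ∈ Icc a b) :
    IntervalIntegrable (fun x => bspline θ a b 2 (i + 1) x * bspline θ a b 2 (k + 1) x)
      volume s t := by
  have h := (continuousOn_bspline_two hθ (k := i + 1) (by omega) (by omega)).mul
    (continuousOn_bspline_two hθ (k := k + 1) (by omega) (by omega))
  exact (h.mono (by rw [uIcc]; exact Icc_subset_Icc (le_inf hs.1 ht.1) (sup_le hs.2 ht.2))).intervalIntegrable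

theorem gram_apply_eq_sum (hθ : IsOpenKnotVector n θ a b) (i k : Fin n) :
    gram θ a b n i k = ∑ j : Fin (n - 1), (θ ((j : ℕ) + 3) - θ ((j : ℕ) + 2)) / 6 *
      (2 * (if (i : ℕ) = j then 1 else 0) * (if (k : ℕ) = j then 1 else 0) +
        (if (i : ℕ) = j then 1 else 0) * (if (k : ℕ) = j + 1 then 1 else 0) +
        (if (i : ℕ) = j + 1 then 1 else 0) * (if (k : ℕ) = j then 1 else 0) +
        2 * (if (i : ℕ) = j + 1 then 1 else 0) * (if (k : ℕ) = j + 1 then 1 else 0)) := by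
  have hn := hθ.two_le
  have hadd := intervalIntegral.sum_integral_adjacent_intervals (μ := volume)
    (f := fun x => bspline θ a b 2 (i + 1) x * bspline θ a b 2 (k + 1) x)
    (a := fun j => θ (j + 2)) (n := n - 1) fun j hj =>
      intervalIntegrable_bspline_two_mul hθ i.2 k.2 (hθ.mem_Icc (by omega) (by omega))
        (hθ.mem_Icc (by omega) (by omega))
  rw [zero_add, hθ.left_two, show n - 1 + 2 = n + 1 by omega, hθ.right_one] at hadd
  rw [gram, Matrix.of_apply, ← hadd, Finset.sum_range]
  refine Finset.sum_congr rfl fun j _ => ?_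
  have hj := j.2
  have hlt := hθ.strict (j + 2) (by omega) (by omega)
  rw [← integral_hat_mul_hat hlt]
  refine intervalIntegral.integral_congr fun x hx => ?_
  rw [uIcc_of_le hlt.le] at hx
  rw [bspline_two_eq hθ (by omega) (by omega) (by omega) (by omega) hx,
    bspline_two_eq hθ (by omega) (by omega) (by omega) (by omega) hx]
  simp only [show ∀ m : ℕ, (m + 1 + 1 = (j : ℕ) + 2) ↔ m = j by intros; omega,
    show ∀ m : ℕ, (m + 1 = (j : ℕ) + 2) ↔ m = j + 1 by intros; omega]

/-- The Gram matrix differs from a diagonal matrix by a weighted graph Laplacian. -/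
theorem gram_eq (hθ : IsOpenKnotVector n θ a b) :
    gram θ a b n = Matrix.diagonal (fun i : Fin n => span θ 2 ((i : ℕ) + 1)) -
      (diffCore (n - 1) n).transpose *
        Matrix.diagonal (fun j : Fin (n - 1) => (θ ((j : ℕ) + 3) - θ ((j : ℕ) + 2)) / 6) *
        diffCore (n - 1) n := by
  have hn := hθ.two_le
  ext i k
  -- An interval of length `d` contributes `(d/6) [2 1; 1 2] = (d/2) I - (d/6) [1 -1; -1 1]`. The
  -- `(d/2) I` parts assemble to `h_{2,i}`; at the two ends the missing half has length zero because
  -- the end knots are double.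
  have hspan : Matrix.diagonal (fun i : Fin n => span θ 2 ((i : ℕ) + 1)) i k =
      ∑ j : Fin (n - 1), (θ ((j : ℕ) + 3) - θ ((j : ℕ) + 2)) / 2 *
        ((if (i : ℕ) = j then 1 else 0) * (if (k : ℕ) = j then 1 else 0) +
          (if (i : ℕ) = j + 1 then 1 else 0) * (if (k : ℕ) = j + 1 then 1 else 0)) := by
    have h := sum_lowerBidiagonal_mul (c := n - 1) (j := i) (by omega)
      (fun j => (θ (j + 3) - θ (j + 2)) / 2 * if (k : ℕ) = j then 1 else 0)
      (fun j => -((θ (j + 3) - θ (j + 2)) / 2 * if (k : ℕ) = j + 1 then 1 else 0))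
      (fun _ => 1) (by
        simp only [show n - 1 + 3 = n + 2 by omega, show n - 1 + 2 = n + 1 by omega,
          hθ.right_one, hθ.right_two]; simp)
    rw [Matrix.diagonal_apply]
    refine Eq.trans ?_ (h.symm.trans (Finset.sum_congr rfl fun j _ => ?_))
    · by_cases hik : i = k
      · subst hik
        rw [if_pos rfl, span]
        rcases Nat.eq_zero_or_pos (i : ℕ) with h0 | h0
        · rw [h0]
          simp only [zero_add, if_true, hθ.left_one, hθ.left_two]
          norm_num [hθ.left_two]
        · simp only [if_true, if_neg h0.ne', Nat.sub_add_cancel h0,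
            show (i : ℕ) - 1 + 3 = i + 2 by omega, show (i : ℕ) - 1 + 2 = i + 1 by omega,
            show (i : ℕ) + 1 + 2 = i + 3 by omega]
          push_cast
          ring
      · have : (k : ℕ) ≠ i := fun h => hik (Fin.ext h.symm)
        rw [if_neg hik]
        simp only [this, if_false]
        split_ifs with h0 h1
        · simp
        · omega
        · simp
    · simp only [eq_comm (a := (j : ℕ)), eq_comm (a := (j : ℕ) + 1)]
      split_ifs <;> ring
  rw [Matrix.sub_apply, hspan, gram_apply_eq_sum hθ, Matrix.mul_apply, ← Finset.sum_sub_distrib]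
  refine Finset.sum_congr rfl fun j _ => ?_
  rw [Matrix.mul_diagonal, Matrix.transpose_apply]
  simp only [diffCore, Matrix.of_apply, diffEntry_eq_sub]
  ring

/-! ### Factorization of `1 - Γ S`, proving (a). -/

/-- The bidiagonal factor of `Z`. -/
def ZFactor (θ : ℕ → ℝ) (n : ℕ) : Matrix (Fin (n - 1)) (Fin (n - 2)) ℝ :=
  Matrix.of fun j m =>
    (if (m : ℕ) = j then (θ ((m : ℕ) + 3) - θ ((m : ℕ) + 2)) *
      (θ ((m : ℕ) + 4) - θ ((m : ℕ) + 3)) ^ 2 / (18 * (θ ((m : ℕ) + 4) - θ ((m : ℕ) + 2))) else 0) -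
    (if (m : ℕ) + 1 = j then (θ ((m : ℕ) + 3) - θ ((m : ℕ) + 2)) ^ 2 *
      (θ ((m : ℕ) + 4) - θ ((m : ℕ) + 3)) / (18 * (θ ((m : ℕ) + 4) - θ ((m : ℕ) + 2))) else 0)

theorem transpose_diffCore_mul_ZFactor (hθ : IsOpenKnotVector n θ a b) :
    (diffCore (n - 1) n).transpose * ZFactor θ n = Z θ n := by
  ext i m
  have hm := m.2
  have hi := i.2
  have h := hθ.lt_of_lt (i := m + 2) (j := m + 4) (by omega) (by omega) (by omega)
  have hd : θ ((m : ℕ) + 4) - θ ((m : ℕ) + 2) ≠ 0 := (sub_pos.2 h).ne'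
  rw [Matrix.mul_apply]
  simp only [Matrix.transpose_apply, diffCore, ZFactor, Z, Matrix.of_apply, mul_sub,
    mul_ite, mul_zero, Finset.sum_sub_distrib]
  simp only [eq_comm (a := (m : ℕ)), eq_comm (a := (m : ℕ) + 1)]
  rw [sum_fin_ite_eq (n - 1) m fun j => diffEntry j i * _,
    sum_fin_ite_eq (n - 1) (m + 1) fun j => diffEntry j i * _, if_pos (by omega),
    if_pos (by omega)]
  simp only [diffEntry, show (m : ℕ) + 1 + 2 = m + 3 by omega, show (m : ℕ) + 1 + 3 = m + 4 by omega,
    show (m : ℕ) + 1 + 1 = m + 2 by omega]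
  rcases (by omega : (i : ℕ) = m ∨ (i : ℕ) = m + 1 ∨ (i : ℕ) = m + 2 ∨
    ((i : ℕ) ≠ m ∧ (i : ℕ) ≠ m + 1 ∧ (i : ℕ) ≠ m + 2)) with h1 | h1 | h1 | ⟨h1, h2, h3⟩
  · simp [h1]
  -- Minus the sum of the two factor entries: with adjacent spans `d₁, d₂`, `(d₁ d₂² + d₁² d₂) / (d₁
  -- + d₂) = d₁ d₂`.
  · simp only [h1]
    simp
    field_simp
    ring
  · simp [h1]
  · simp [h1, h2, h3]

/-- The left side is what remains of `1 - Γ S` after `Cᵀ` is taken out on the left and `D2` on the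
right. Both sides are tridiagonal, so the identity is checked on the three diagonals, with the first
diagonal entry treated separately. -/
theorem diagonal_add_eq_ZFactor_mul_D3 (hθ : IsOpenKnotVector n θ a b) :
    Matrix.diagonal (fun j : Fin (n - 1) => (θ ((j : ℕ) + 3) - θ ((j : ℕ) + 2)) / 6) +
      (Matrix.diagonal (fun j : Fin (n - 1) => (θ ((j : ℕ) + 3) - θ ((j : ℕ) + 2)) / 6) *
        (D2 θ n * (diffCore (n - 1) n).transpose) - 1) *
      Matrix.diagonal (fun i : Fin (n - 1) => (θ ((i : ℕ) + 1 + 2) - θ ((i : ℕ) + 1 + 1)) ^ 2 /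
        (2 * (θ ((i : ℕ) + 1 + 3) - θ ((i : ℕ) + 1)))) = ZFactor θ n * D3 θ n := by
  have hn := hθ.two_le
  ext j k
  have hj := j.2
  have hk := k.2
  have h1 : (D2 θ n * (diffCore (n - 1) n).transpose) j k =
      (span θ 2 (j + 1))⁻¹ * diffEntry k j - (span θ 2 (j + 1 + 1))⁻¹ * diffEntry k (j + 1) := by
    rw [← sum_diffEntry_mul (c := n) (by omega) fun i => (span θ 2 (i + 1))⁻¹ * diffEntry k i,
      Matrix.mul_apply]
    refine Finset.sum_congr rfl fun i _ => ?_
    rw [D2, diffMatrix_eq, Matrix.mul_diagonal, mul_assoc]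
    rfl
  have h2 : (ZFactor θ n * D3 θ n) j k = ((θ ((j : ℕ) + 3) - θ ((j : ℕ) + 2)) *
      (θ ((j : ℕ) + 4) - θ ((j : ℕ) + 3)) ^ 2 / (18 * (θ ((j : ℕ) + 4) - θ ((j : ℕ) + 2))) *
      diffEntry j k - if (j : ℕ) = 0 then 0 else
      (θ ((j - 1 : ℕ) + 3) - θ ((j - 1 : ℕ) + 2)) ^ 2 *
      (θ ((j - 1 : ℕ) + 4) - θ ((j - 1 : ℕ) + 3)) /
        (18 * (θ ((j - 1 : ℕ) + 4) - θ ((j - 1 : ℕ) + 2))) * diffEntry (j - 1) k) *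
      (span θ 3 (k + 1))⁻¹ := by
    rw [D3, diffMatrix_eq, ← Matrix.mul_assoc, Matrix.mul_diagonal]
    congr 1
    exact sum_lowerBidiagonal_mul (c := n - 2) (j := j) (by omega)
      (fun m => (θ (m + 3) - θ (m + 2)) * (θ (m + 4) - θ (m + 3)) ^ 2 /
        (18 * (θ (m + 4) - θ (m + 2))))
      -- The out-of-range diagonal entry `m = n - 2` vanishes since `θ (n + 1) = θ (n + 2)`.
      (fun m => (θ (m + 3) - θ (m + 2)) ^ 2 * (θ (m + 4) - θ (m + 3)) /
        (18 * (θ (m + 4) - θ (m + 2)))) (fun m => diffEntry m k) (by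
        simp only [show n - 2 + 4 = n + 2 by omega, show n - 2 + 3 = n + 1 by omega,
          hθ.right_one, hθ.right_two]; simp)
  rw [h2, Matrix.add_apply, Matrix.mul_diagonal, Matrix.sub_apply, Matrix.diagonal_mul, h1]
  simp only [span, add_assoc, Nat.reduceAdd]
  push_cast
  have hj2 : θ ((j : ℕ) + 3) - θ ((j : ℕ) + 1) ≠ 0 :=
    (sub_pos.2 (hθ.lt_add (k := j + 1) (s := 2) (by omega) (by omega) (by omega))).ne'
  have hj2' : θ ((j : ℕ) + 4) - θ ((j : ℕ) + 2) ≠ 0 :=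
    (sub_pos.2 (hθ.lt_add (k := j + 2) (s := 2) (by omega) (by omega) (by omega))).ne'
  have hk3 : θ ((k : ℕ) + 4) - θ ((k : ℕ) + 1) ≠ 0 :=
    (sub_pos.2 (hθ.lt_add (k := k + 1) (s := 3) (by omega) (by omega) (by omega))).ne'
  by_cases hjk : j = k
  · subst hjk
    rw [Matrix.diagonal_apply_eq, Matrix.one_apply_eq]
    rcases Nat.eq_zero_or_pos (j : ℕ) with h0 | h0
    -- The double knot at `a` compensates for the absent subdiagonal term in the first row.
    · have h21 : θ 2 = θ 1 := hθ.left_two.trans hθ.left_one.symm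
      rw [h0] at hj2 hj2' hk3 ⊢
      simp only [zero_add, h21, diffEntry] at *
      norm_num
      field_simp
      ring
    · obtain ⟨i, hi⟩ : ∃ i, (j : ℕ) = i + 1 := ⟨j - 1, by omega⟩
      rw [hi] at hj2 hj2' hk3 ⊢
      simp only [diffEntry, Nat.add_one_sub_one, Nat.succ_ne_zero, if_false] at *
      norm_num [add_assoc] at hj2 hj2' hk3 ⊢
      field_simp
      ring
  · have hjk' : (j : ℕ) ≠ k := fun h => hjk (Fin.ext h)
    rw [Matrix.diagonal_apply_ne _ hjk, Matrix.one_apply_ne hjk]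
    by_cases h3 : (k : ℕ) = j + 1
    · have e1 : diffEntry (j + 1) j = 0 := by rw [diffEntry, if_neg (by omega), if_neg (by omega)]
      have e2 : diffEntry j (j + 1) = -1 := by simp [diffEntry]
      have e3 : diffEntry (j + 1) (j + 1) = 1 := by simp [diffEntry]
      have e4 : (j : ℕ) ≠ 0 → diffEntry (j - 1) (j + 1) = 0 := fun h0 => by
        rw [diffEntry, if_neg (by omega), if_neg (by omega)]
      rw [h3] at hk3 ⊢
      simp only [add_assoc, Nat.reduceAdd] at hk3 ⊢
      rw [e1, e2, e3]
      split_ifs with h0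
      · field_simp
        ring
      · rw [e4 h0]
        field_simp
        ring
    · by_cases h4 : (j : ℕ) = k + 1
      · rw [h4] at hj2 hj2' ⊢
        simp [diffEntry, add_assoc] at hj2 ⊢
        field_simp
        ring
      · have e1 : diffEntry k j = 0 := by simp [diffEntry, hjk', h4]
        have e2 : diffEntry j k = 0 := by simp [diffEntry, hjk'.symm, h3]
        have e3 : diffEntry k (j + 1) = 0 := by
          rw [diffEntry, if_neg (by omega), if_neg (by omega)]
        rw [e1, e2, e3]
        split_ifs with h0
        · simp
        · have e4 : diffEntry (j - 1) k = 0 := by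
            rw [diffEntry, if_neg (by omega), if_neg (by omega)]
          simp [e4]

theorem one_sub_gram_mul_S (hθ : IsOpenKnotVector n θ a b) :
    1 - gram θ a b n * S θ n = Z θ n * D3 θ n * D2 θ n := by
  have hH : Matrix.diagonal (fun i : Fin n => span θ 2 ((i : ℕ) + 1)) *
      Matrix.diagonal (fun i : Fin n => (span θ 2 ((i : ℕ) + 1))⁻¹) = 1 := by
    rw [Matrix.diagonal_mul_diagonal, ← Matrix.diagonal_one]
    congr 1
    ext i
    have hi := i.2
    have := hθ.lt_add (k := i + 1) (s := 2) (by omega) le_rfl (by omega)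
    refine mul_inv_cancel₀ ?_
    rw [span]
    exact (div_pos (sub_pos.2 this) (by norm_num)).ne'
  have hD : D2 θ n = diffCore (n - 1) n *
      Matrix.diagonal (fun i : Fin n => (span θ 2 ((i : ℕ) + 1))⁻¹) := rfl
  have hU : Matrix.diagonal (fun i : Fin n => 2 / (θ ((i : ℕ) + 1 + 2) - θ ((i : ℕ) + 1))) =
      Matrix.diagonal (fun i : Fin n => (span θ 2 ((i : ℕ) + 1))⁻¹) := by
    congr 1
    ext i
    rw [span, inv_div]
    norm_num
  have hGU : gram θ a b n * Matrix.diagonal (fun i : Fin n => (span θ 2 ((i : ℕ) + 1))⁻¹) =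
      1 - (diffCore (n - 1) n).transpose * Matrix.diagonal
        (fun j : Fin (n - 1) => (θ ((j : ℕ) + 3) - θ ((j : ℕ) + 2)) / 6) * D2 θ n := by
    rw [gram_eq hθ, Matrix.sub_mul, hH, hD]
    simp only [Matrix.mul_assoc]
  -- As `D2ᵀ = H⁻¹ Cᵀ`, this follows from the formula for `Γ H⁻¹`.
  have hGD : gram θ a b n * (D2 θ n).transpose = (1 - (diffCore (n - 1) n).transpose *
      Matrix.diagonal (fun j : Fin (n - 1) => (θ ((j : ℕ) + 3) - θ ((j : ℕ) + 2)) / 6) *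
        D2 θ n) * (diffCore (n - 1) n).transpose := by
    rw [← hGU]
    conv_lhs => rw [hD, Matrix.transpose_mul, Matrix.diagonal_transpose, ← Matrix.mul_assoc]
  rw [S, hU, ← transpose_diffCore_mul_ZFactor hθ, Matrix.mul_assoc _ (ZFactor θ n),
    ← diagonal_add_eq_ZFactor_mul_D3 hθ, Matrix.mul_add, hGU, ← Matrix.mul_assoc, ← Matrix.mul_assoc, hGD]
  simp only [Matrix.mul_assoc, Matrix.mul_add, Matrix.add_mul, Matrix.sub_mul, Matrix.mul_sub,
    Matrix.one_mul]
  abel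

/-! ### Moments of linear splines and divided differences. -/

theorem diffMatrix_mulVec {q r c : ℕ} (hrc : r < c) (v : ℕ → ℝ) (i : Fin r) :
    (diffMatrix θ q r c *ᵥ fun k => v k) i =
      v i * (span θ q (i + 1))⁻¹ - v (i + 1) * (span θ q (i + 2))⁻¹ := by
  rw [← sum_diffEntry_mul (c := c) (by omega) fun k => v k * (span θ q (k + 1))⁻¹,
    Matrix.mulVec, dotProduct]
  refine Finset.sum_congr rfl fun k _ => ?_
  rw [diffMatrix_eq, Matrix.mul_diagonal, mul_assoc, mul_comm (v k)]
  rfl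

theorem diffCore_mulVec {r c : ℕ} (hrc : r < c) (v : ℕ → ℝ) (i : Fin r) :
    (diffCore r c *ᵥ fun k => v k) i = v i - v (i + 1) :=
  sum_diffEntry_mul (c := c) (by omega) v

/-- The inner products of the linear spline with values `c k` at `θ k` with the B-splines. -/
theorem vecMul_gram (hθ : IsOpenKnotVector n θ a b) (c : ℕ → ℝ) (i : Fin n) :
    ((fun m : Fin n => c (m + 2)) ᵥ* gram θ a b n) i =
      (θ ((i : ℕ) + 3) - θ ((i : ℕ) + 2)) / 6 * (2 * c (i + 2) + c (i + 3)) +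
      (θ ((i : ℕ) + 2) - θ ((i : ℕ) + 1)) / 6 * (2 * c (i + 2) + c (i + 1)) := by
  have hn := hθ.two_le
  have hi := i.2
  rw [gram_eq hθ, Matrix.vecMul_sub, Matrix.mul_assoc, ← Matrix.vecMul_vecMul,
    Matrix.vecMul_transpose, Pi.sub_apply, Matrix.vecMul_diagonal]
  have h : ((diffCore (n - 1) n *ᵥ fun m : Fin n => c (m + 2)) ᵥ*
      (Matrix.diagonal (fun j : Fin (n - 1) => (θ ((j : ℕ) + 3) - θ ((j : ℕ) + 2)) / 6) *
        diffCore (n - 1) n)) i =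
      (θ ((i : ℕ) + 3) - θ ((i : ℕ) + 2)) / 6 * (c (i + 2) - c (i + 3)) - if (i : ℕ) = 0 then 0 else
        (θ ((i - 1 : ℕ) + 3) - θ ((i - 1 : ℕ) + 2)) / 6 *
          (c ((i - 1 : ℕ) + 2) - c ((i - 1 : ℕ) + 3)) := by
    rw [← sum_lowerBidiagonal_mul (c := n - 1) (j := i) (by omega)
      (fun j => (θ (j + 3) - θ (j + 2)) / 6) (fun j => (θ (j + 3) - θ (j + 2)) / 6)
      (fun j => c (j + 2) - c (j + 3)) (by
        simp only [show n - 1 + 3 = n + 2 by omega, show n - 1 + 2 = n + 1 by omega,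
          hθ.right_one, hθ.right_two]; simp), Matrix.vecMul, dotProduct]
    refine Finset.sum_congr rfl fun j _ => ?_
    rw [diffCore_mulVec (by omega) fun m => c (m + 2), Matrix.diagonal_mul, diffCore,
      Matrix.of_apply, diffEntry_eq_sub]
    simp only [eq_comm (a := (i : ℕ)), add_right_comm _ 1 2]
    split_ifs <;> ring
  rw [h, span]
  split_ifs with h0
  · rw [h0]
    simp only [zero_add, hθ.left_two, hθ.left_one]
    norm_num
    ring
  · obtain ⟨k, hk⟩ : ∃ k, (i : ℕ) = k + 1 := ⟨i - 1, by omega⟩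
    rw [hk]
    simp only [Nat.add_one_sub_one, add_assoc, Nat.reduceAdd]
    push_cast
    ring

/-- If `G` is a function that satisfies the Taylor formulas of a cubic spline with second
derivative `6 c`, then the second derivatives of the cubic B-splines, tested against `c`, give the
fourth divided differences of `G`. -/
theorem vecMul_gram_mul_transpose (hθ : IsOpenKnotVector n θ a b) (c : ℕ → ℝ) (G : ℝ → ℝ)
    (hl : ∀ j, 2 ≤ j → j ≤ n → G (θ (j + 1)) = G (θ j) + deriv G (θ j) * (θ (j + 1) - θ j) +
      (θ (j + 1) - θ j) ^ 2 * (2 * c j + c (j + 1)))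
    (hr : ∀ j, 2 ≤ j → j ≤ n → G (θ j) = G (θ (j + 1)) - deriv G (θ (j + 1)) * (θ (j + 1) - θ j) +
      (θ (j + 1) - θ j) ^ 2 * (2 * c (j + 1) + c j)) (k : Fin (n - 2)) :
    ((fun m : Fin n => c (m + 2)) ᵥ*
      (gram θ a b n * (D2 θ n).transpose * (D3 θ n).transpose)) k =
      (θ ((k : ℕ) + 5) - θ ((k : ℕ) + 1)) * divDiff θ G 4 (k + 1) := by
  have hn := hθ.two_le
  have hk := k.2
  -- `hdr` expands at the right node and `hdl` at the left one; at a double knot the correction term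
  -- is zero. In `e0` both expansions are taken at the common node `θ (i + 2)`, so `deriv G` cancels
  -- and six times the moment from `vecMul_gram` remains.
  have hdr : ∀ i, 1 ≤ i → i ≤ n →
      divDiff θ G 1 i = deriv G (θ (i + 1)) - (θ (i + 1) - θ i) * (2 * c (i + 1) + c i) := by
    intro i h1 h2
    rw [divDiff_one]
    rcases hθ.endpoint_or_lt h1 (by omega) with ⟨-, h3, h4⟩ | ⟨h, -, -⟩ | ⟨h3, h4, h⟩
    · rw [h3, h4]; simp
    · omega
    · rw [if_neg h.ne, div_eq_iff (sub_pos.2 h).ne', hr i h3 h4]; ring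
  have hdl : ∀ i, 2 ≤ i → i ≤ n + 1 →
      divDiff θ G 1 i = deriv G (θ i) + (θ (i + 1) - θ i) * (2 * c i + c (i + 1)) := by
    intro i h1 h2
    rw [divDiff_one]
    rcases hθ.endpoint_or_lt (by omega) h2 with ⟨h, -, -⟩ | ⟨-, h3, h4⟩ | ⟨h3, h4, h⟩
    · omega
    · rw [h3, h4]; simp
    · rw [if_neg h.ne, div_eq_iff (sub_pos.2 h).ne', hl i h3 h4]; ring
  have e0 : ((fun m : Fin n => c (m + 2)) ᵥ* gram θ a b n) =
      fun i : Fin n => (θ ((i : ℕ) + 3) - θ ((i : ℕ) + 1)) * divDiff θ G 2 (i + 1) / 6 := by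
    ext i
    have hi := i.2
    have := sub_pos.2 (hθ.lt_add (k := i + 1) (s := 2) (by omega) (by omega) (by omega))
    rw [vecMul_gram hθ, hθ.divDiff_add_two (j := 0) _ (by omega) (by omega),
      hdl _ (by omega) (by omega), hdr _ (by omega) (by omega)]
    simp only [add_assoc, Nat.reduceAdd] at this ⊢
    rw [mul_div_cancel₀ _ this.ne']
    ring
  -- Each difference matrix raises the order of the divided difference, flips the sign and
  -- contributes the `j` of `h_{j,k}`: in total `(1/6) · (-2) · (-3) = 1`.
  have e1 : (D2 θ n *ᵥ
      fun i : Fin n => (θ ((i : ℕ) + 3) - θ ((i : ℕ) + 1)) * divDiff θ G 2 (i + 1) / 6) =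
      fun i : Fin (n - 1) => -((θ ((i : ℕ) + 4) - θ ((i : ℕ) + 1)) * divDiff θ G 3 (i + 1) / 3) := by
    ext i
    have hi := i.2
    have h1 := sub_pos.2 (hθ.lt_add (k := i + 1) (s := 2) (by omega) (by omega) (by omega))
    have h2 := sub_pos.2 (hθ.lt_add (k := i + 2) (s := 2) (by omega) (by omega) (by omega))
    have h3 := sub_pos.2 (hθ.lt_add (k := i + 1) (s := 3) (by omega) (by omega) (by omega))
    rw [D2, diffMatrix_mulVec (by omega)
      (fun i : ℕ => (θ (i + 3) - θ (i + 1)) * divDiff θ G 2 (i + 1) / 6),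
      hθ.divDiff_add_two (j := 1) _ (by omega) (by omega), span, span]
    simp only [add_assoc, Nat.reduceAdd] at h1 h2 h3 ⊢
    rw [mul_div_cancel₀ _ h3.ne']
    push_cast
    field_simp
    ring
  rw [← Matrix.vecMul_vecMul, ← Matrix.vecMul_vecMul, Matrix.vecMul_transpose,
    Matrix.vecMul_transpose, e0, e1, D3, diffMatrix_mulVec (by omega)
      (fun i : ℕ => -((θ (i + 4) - θ (i + 1)) * divDiff θ G 3 (i + 1) / 3)),
    hθ.divDiff_add_two (j := 2) _ (by omega) (by omega), span, span]
  have h1 := sub_pos.2 (hθ.lt_add (k := k + 1) (s := 3) (by omega) (by omega) (by omega))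
  have h2 := sub_pos.2 (hθ.lt_add (k := k + 2) (s := 3) (by omega) (by omega) (by omega))
  have h3 := sub_pos.2 (hθ.lt_add (k := k + 1) (s := 4) (by omega) (by omega) (by omega))
  simp only [add_assoc, Nat.reduceAdd] at h1 h2 h3 ⊢
  rw [mul_div_cancel₀ _ h3.ne']
  push_cast
  field_simp
  ring

/-- The right side is `κ` at knot `m + 3` times the slope jump there of the linear spline with
values `c`. It therefore vanishes on linear data and isolates the kink of a truncated power. -/
theorem vecMul_Z (hθ : IsOpenKnotVector n θ a b) (c : ℕ → ℝ) (m : Fin (n - 2)) :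
    ((fun m : Fin n => c (m + 2)) ᵥ* Z θ n) m =
      (c (m + 2) - c (m + 3)) * ((θ ((m : ℕ) + 3) - θ ((m : ℕ) + 2)) *
        (θ ((m : ℕ) + 4) - θ ((m : ℕ) + 3)) ^ 2 / (18 * (θ ((m : ℕ) + 4) - θ ((m : ℕ) + 2)))) -
      (c (m + 3) - c (m + 4)) * ((θ ((m : ℕ) + 3) - θ ((m : ℕ) + 2)) ^ 2 *
        (θ ((m : ℕ) + 4) - θ ((m : ℕ) + 3)) / (18 * (θ ((m : ℕ) + 4) - θ ((m : ℕ) + 2)))) := by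
  have hn := hθ.two_le
  have hm := m.2
  rw [← transpose_diffCore_mul_ZFactor hθ, ← Matrix.vecMul_vecMul, Matrix.vecMul_transpose]
  have : (diffCore (n - 1) n *ᵥ fun m : Fin n => c (m + 2)) =
      fun j : Fin (n - 1) => c (j + 2) - c (j + 3) := by
    ext j
    rw [diffCore_mulVec (by omega) fun m => c (m + 2), add_right_comm]
  rw [this, Matrix.vecMul_eq_sum, Finset.sum_apply]
  simp only [Pi.smul_apply, smul_eq_mul, ZFactor, Matrix.of_apply, mul_sub (_ - _), mul_ite,
    mul_zero, Finset.sum_sub_distrib]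
  simp only [eq_comm (a := (m : ℕ)), eq_comm (a := (m : ℕ) + 1)]
  rw [sum_fin_ite_eq (n - 1) m fun j => (c (j + 2) - c (j + 3)) * _,
    sum_fin_ite_eq (n - 1) (m + 1) fun j => (c (j + 2) - c (j + 3)) * _, if_pos (by omega),
    if_pos (by omega)]

/-! ### Reproduction by the kernel, proving (b). -/

theorem linearSpline_eq_sum (hθ : IsOpenKnotVector n θ a b) {f : ℝ → ℝ}
    (hf : ∀ j, 2 ≤ j → j ≤ n → ∀ x ∈ Icc (θ j) (θ (j + 1)),
      f x = f (θ j) * ((θ (j + 1) - x) / (θ (j + 1) - θ j)) +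
        f (θ (j + 1)) * ((x - θ j) / (θ (j + 1) - θ j))) {x : ℝ} (hx : x ∈ Icc a b) :
    f x = ∑ m : Fin n, f (θ ((m : ℕ) + 2)) * bspline θ a b 2 ((m : ℕ) + 1) x := by
  obtain ⟨j, hj, hjn, hxj⟩ := hθ.exists_mem_Icc hx
  rw [hf j hj hjn x hxj]
  obtain ⟨i, rfl⟩ : ∃ i, j = i + 2 := ⟨j - 2, by omega⟩
  have h : ∀ m : Fin n, f (θ ((m : ℕ) + 2)) * bspline θ a b 2 ((m : ℕ) + 1) x =
      (if (m : ℕ) = i then f (θ ((m : ℕ) + 2)) *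
        ((θ (i + 2 + 1) - x) / (θ (i + 2 + 1) - θ (i + 2))) else 0) +
      (if (m : ℕ) = i + 1 then f (θ ((m : ℕ) + 2)) *
        ((x - θ (i + 2)) / (θ (i + 2 + 1) - θ (i + 2))) else 0) := fun m => by
    have hm := m.2
    rw [bspline_two_eq hθ (by omega) (by omega) hj hjn hxj]
    simp only [show ((m : ℕ) + 1 + 1 = i + 2) ↔ (m : ℕ) = i by omega,
      show ((m : ℕ) + 1 = i + 2) ↔ (m : ℕ) = i + 1 by omega]
    split_ifs <;> ring
  rw [Finset.sum_congr rfl fun m _ => h m, Finset.sum_add_distrib,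
    sum_fin_ite_eq n i fun m => f (θ (m + 2)) * _,
    sum_fin_ite_eq n (i + 1) fun m => f (θ (m + 2)) * _, if_pos (by omega), if_pos (by omega)]

/-- Since `f = ∑ c_m N_{2,m}`, the integral is `c Γ S_L Φ₂(x)ᵀ`, and it suffices that `c Γ S_L = c`.
By (a), `Γ S_L = 1 - Z D3 D2 + Γ D2ᵀ D3ᵀ U D3 D2`, and `hU` cancels the last two terms. -/
theorem reproduces_of_vecMul (hθ : IsOpenKnotVector n θ a b) {f : ℝ → ℝ}
    (hf : ∀ j, 2 ≤ j → j ≤ n → ∀ x ∈ Icc (θ j) (θ (j + 1)),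
      f x = f (θ j) * ((θ (j + 1) - x) / (θ (j + 1) - θ j)) +
        f (θ (j + 1)) * ((x - θ j) / (θ (j + 1) - θ j)))
    {U : Matrix (Fin (n - 2)) (Fin (n - 2)) ℝ}
    (hU : (fun m : Fin n => f (θ ((m : ℕ) + 2))) ᵥ* Z θ n =
      ((fun m : Fin n => f (θ ((m : ℕ) + 2))) ᵥ*
        (gram θ a b n * (D2 θ n).transpose * (D3 θ n).transpose)) ᵥ* U) :
    Reproduces a b (kernelL θ a b n U) f := by
  set c : Fin n → ℝ := fun m => f (θ ((m : ℕ) + 2)) with hc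
  have hS : c ᵥ* (gram θ a b n * SL θ n U) = c := by
    have h1 : gram θ a b n * SL θ n U = 1 - Z θ n * (D3 θ n * D2 θ n) +
        (gram θ a b n * (D2 θ n).transpose * (D3 θ n).transpose) * U * (D3 θ n * D2 θ n) := by
      rw [SL, Matrix.mul_add, ← Matrix.mul_assoc (Z θ n), ← one_sub_gram_mul_S hθ]
      simp only [Matrix.mul_assoc]
      abel
    rw [h1, Matrix.vecMul_add, Matrix.vecMul_sub, Matrix.vecMul_one,
      ← Matrix.vecMul_vecMul _ (Z θ n), ← Matrix.vecMul_vecMul _ (_ * U),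
      ← Matrix.vecMul_vecMul _ _ U, hU]
    abel
  intro x hx
  set v : Fin n → ℝ := SL θ n U *ᵥ fun k : Fin n => bspline θ a b 2 ((k : ℕ) + 1) x with hv
  have hfun : EqOn (fun y => f y * kernelL θ a b n U x y) (fun y => ∑ m : Fin n, ∑ i : Fin n,
      c m * v i * (bspline θ a b 2 ((m : ℕ) + 1) y * bspline θ a b 2 ((i : ℕ) + 1) y))
      (uIcc a b) := fun y hy => by
    rw [uIcc_of_le hθ.a_lt_b.le] at hy
    have hL : kernelL θ a b n U x y = ∑ i : Fin n, v i * bspline θ a b 2 ((i : ℕ) + 1) y := by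
      refine Finset.sum_congr rfl fun i _ => ?_
      rw [hv, Matrix.mulVec, dotProduct, Finset.sum_mul]
      exact Finset.sum_congr rfl fun k _ => by ring
    simp only
    rw [hL, linearSpline_eq_sum hθ hf hy, Finset.sum_mul_sum]
    exact Finset.sum_congr rfl fun m _ => Finset.sum_congr rfl fun i _ => by rw [hc]; ring
  have hint : ∀ m i : Fin n, IntervalIntegrable (fun y => c m * v i *
      (bspline θ a b 2 ((m : ℕ) + 1) y * bspline θ a b 2 ((i : ℕ) + 1) y)) volume a b :=
    fun m i => (intervalIntegrable_bspline_two_mul hθ m.2 i.2 (left_mem_Icc.2 hθ.a_lt_b.le)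
      (right_mem_Icc.2 hθ.a_lt_b.le)).const_mul _
  have hint' : ∀ m : Fin n, IntervalIntegrable (fun y => ∑ i : Fin n, c m * v i *
      (bspline θ a b 2 ((m : ℕ) + 1) y * bspline θ a b 2 ((i : ℕ) + 1) y)) volume a b := fun m => by
    simpa only [Finset.sum_fn] using IntervalIntegrable.sum Finset.univ fun i _ => hint m i
  constructor
  · refine IntervalIntegrable.congr (hfun.symm.mono uIoc_subset_uIcc) ?_
    simpa only [Finset.sum_fn] using IntervalIntegrable.sum Finset.univ fun m _ => hint' m
  · rw [intervalIntegral.integral_congr hfun,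
      intervalIntegral.integral_finsetSum fun m _ => hint' m]
    have h1 : ∀ m : Fin n, ∫ y in a..b, (∑ i : Fin n, c m * v i *
        (bspline θ a b 2 ((m : ℕ) + 1) y * bspline θ a b 2 ((i : ℕ) + 1) y)) =
        c m * (gram θ a b n *ᵥ v) m := fun m => by
      rw [intervalIntegral.integral_finsetSum fun i _ => hint m i, Matrix.mulVec, dotProduct,
        Finset.mul_sum]
      refine Finset.sum_congr rfl fun i _ => ?_
      rw [intervalIntegral.integral_const_mul, gram, Matrix.of_apply]
      ring
    rw [Finset.sum_congr rfl fun m _ => h1 m, linearSpline_eq_sum hθ hf hx]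
    change c ⬝ᵥ (gram θ a b n *ᵥ v) = c ⬝ᵥ fun k : Fin n => bspline θ a b 2 ((k : ℕ) + 1) x
    rw [hv, Matrix.mulVec_mulVec, Matrix.dotProduct_mulVec, hS]

theorem Reproduces.add {L : ℝ → ℝ → ℝ} {f g : ℝ → ℝ} (hf : Reproduces a b L f)
    (hg : Reproduces a b L g) : Reproduces a b L fun x => f x + g x := fun x hx => by
  obtain ⟨h1, h2⟩ := hf x hx
  obtain ⟨h3, h4⟩ := hg x hx
  simp only [add_mul]
  exact ⟨h1.add h3, by rw [intervalIntegral.integral_add h1 h3, h2, h4]⟩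

theorem Reproduces.const_mul {L : ℝ → ℝ → ℝ} {f : ℝ → ℝ} (r : ℝ) (hf : Reproduces a b L f) :
    Reproduces a b L fun x => r * f x := fun x hx => by
  obtain ⟨h1, h2⟩ := hf x hx
  simp only [mul_assoc]
  exact ⟨h1.const_mul r, by rw [intervalIntegral.integral_const_mul, h2]⟩

/-- `3 t ^ 2` and, in `divDiff_cube`, `t ^ 3` are the functions `G` with `G'' = 6 f` for `f = 1` and
`f = x`. -/
theorem divDiff_sq (hθ : IsOpenKnotVector n θ a b) {k : ℕ} (hk : 1 ≤ k) (hk' : k + 4 ≤ n + 2) :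
    divDiff θ (fun t => 3 * t ^ 2) 4 k = 0 := by
  have h1 : ∀ i, divDiff θ (fun t => 3 * t ^ 2) 1 i = 3 * (θ i + θ (i + 1)) := fun i => by
    rw [divDiff_one]
    split_ifs with h
    · rw [← h]; simp; ring
    · rw [div_eq_iff (sub_ne_zero.2 (Ne.symm h))]; ring
  have h2 : ∀ i, 1 ≤ i → i ≤ n → divDiff θ (fun t => 3 * t ^ 2) 2 i = 3 := fun i hi hi' => by
    have := sub_pos.2 (hθ.lt_add hi le_rfl (by omega))
    rw [hθ.divDiff_add_two (j := 0) _ hi (by omega), zero_add, h1, h1, div_eq_iff this.ne']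
    ring
  have h3 : ∀ i, 1 ≤ i → i + 1 ≤ n → divDiff θ (fun t => 3 * t ^ 2) 3 i = 0 := fun i hi hi' => by
    rw [hθ.divDiff_add_two (j := 1) _ hi (by omega), h2 _ hi (by omega), h2 _ (by omega) hi',
      sub_self, zero_div]
  rw [hθ.divDiff_add_two (j := 2) _ hk hk', h3 _ hk (by omega), h3 _ (by omega) (by omega),
    sub_self, zero_div]

theorem divDiff_cube (hθ : IsOpenKnotVector n θ a b) {k : ℕ} (hk : 1 ≤ k) (hk' : k + 4 ≤ n + 2) :
    divDiff θ (fun t => t ^ 3) 4 k = 0 := by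
  have h1 : ∀ i, divDiff θ (fun t => t ^ 3) 1 i =
      θ i ^ 2 + θ i * θ (i + 1) + θ (i + 1) ^ 2 := fun i => by
    rw [divDiff_one]
    split_ifs with h
    · rw [← h]; simp; ring
    · rw [div_eq_iff (sub_ne_zero.2 (Ne.symm h))]; ring
  have h2 : ∀ i, 1 ≤ i → i ≤ n →
      divDiff θ (fun t => t ^ 3) 2 i = θ i + θ (i + 1) + θ (i + 2) := fun i hi hi' => by
    have := sub_pos.2 (hθ.lt_add hi le_rfl (by omega))
    rw [hθ.divDiff_add_two (j := 0) _ hi (by omega), zero_add, h1, h1, div_eq_iff this.ne']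
    ring
  have h3 : ∀ i, 1 ≤ i → i + 1 ≤ n → divDiff θ (fun t => t ^ 3) 3 i = 1 := fun i hi hi' => by
    have := sub_pos.2 (hθ.lt_add (s := 3) hi (by omega) (by omega))
    rw [hθ.divDiff_add_two (j := 1) _ hi (by omega), h2 _ hi (by omega), h2 _ (by omega) hi',
      div_eq_iff this.ne']
    ring
  rw [hθ.divDiff_add_two (j := 2) _ hk hk', h3 _ hk (by omega), h3 _ (by omega) (by omega),
    sub_self, zero_div]

theorem reproduces_one (hθ : IsOpenKnotVector n θ a b) (U : Matrix (Fin (n - 2)) (Fin (n - 2)) ℝ) :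
    Reproduces a b (kernelL θ a b n U) fun _ => 1 := by
  refine reproduces_of_vecMul hθ (fun j h1 h2 x _ => ?_) ?_
  · have := sub_pos.2 (hθ.strict j h1 h2)
    field_simp
    ring
  · have hd : ∀ t : ℝ, deriv (fun t : ℝ => 3 * t ^ 2) t = 6 * t := fun t => by simp; ring
    have h : (fun m : Fin n => (1 : ℝ)) ᵥ*
        (gram θ a b n * (D2 θ n).transpose * (D3 θ n).transpose) = 0 := by
      ext k
      rw [vecMul_gram_mul_transpose hθ (fun _ => 1) (fun t => 3 * t ^ 2)
        (fun j _ _ => by rw [hd]; ring) (fun j _ _ => by rw [hd]; ring),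
        divDiff_sq hθ (by omega) (by omega), mul_zero, Pi.zero_apply]
    rw [h, Matrix.zero_vecMul]
    ext m
    rw [vecMul_Z hθ fun _ => 1]
    simp

theorem reproduces_id (hθ : IsOpenKnotVector n θ a b) (U : Matrix (Fin (n - 2)) (Fin (n - 2)) ℝ) :
    Reproduces a b (kernelL θ a b n U) fun x => x := by
  refine reproduces_of_vecMul hθ (fun j h1 h2 x _ => ?_) ?_
  · have := sub_pos.2 (hθ.strict j h1 h2)
    field_simp
    ring
  · have hd : ∀ t : ℝ, deriv (fun t : ℝ => t ^ 3) t = 3 * t ^ 2 := fun t => by simp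
    have h : (fun m : Fin n => θ ((m : ℕ) + 2)) ᵥ*
        (gram θ a b n * (D2 θ n).transpose * (D3 θ n).transpose) = 0 := by
      ext k
      rw [vecMul_gram_mul_transpose hθ θ (fun t => t ^ 3)
        (fun j _ _ => by rw [hd]; ring) (fun j _ _ => by rw [hd]; ring),
        divDiff_cube hθ (by omega) (by omega), mul_zero, Pi.zero_apply]
    rw [h, Matrix.zero_vecMul]
    ext m
    rw [vecMul_Z hθ θ, Pi.zero_apply]
    ring

theorem reproduces_truncPow (hθ : IsOpenKnotVector n θ a b) {r : ℕ} {l : Fin r → ℕ}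
    (hl : ∀ j, 3 ≤ l j ∧ l j ≤ n) {U : Matrix (Fin (n - 2)) (Fin (n - 2)) ℝ}
    (hU : collocA θ a b n l * U = rhsB θ n l) (s : Fin r) :
    Reproduces a b (kernelL θ a b n U) fun x => max (x - θ (l s)) 0 := by
  obtain ⟨hl3, hln⟩ := hl s
  have hle : ∀ j, 2 ≤ j → j ≤ n → θ (j + 1) ≤ θ (l s) ∨ θ (l s) ≤ θ j := fun j h1 h2 => by
    rcases (by omega : j + 1 ≤ l s ∨ l s ≤ j) with h | h
    · exact Or.inl (hθ.le_of_le (by omega) h (by omega))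
    · exact Or.inr (hθ.le_of_le (by omega) h (by omega))
  refine reproduces_of_vecMul hθ (fun j h1 h2 x hx => ?_) ?_
  · have hd := sub_pos.2 (hθ.strict j h1 h2)
    rcases hle j h1 h2 with h | h
    · rw [max_eq_right (by linarith [hx.2]), max_eq_right (by linarith),
        max_eq_right (by linarith)]
      ring
    · rw [max_eq_left (by linarith [hx.1]), max_eq_left (by linarith), max_eq_left (by linarith)]
      field_simp
      ring
  -- Take `G = (· - θ_ℓ)_+^3`: its scaled fourth divided difference is by definition the cubic
  -- B-spline at `θ_ℓ`. The Taylor formulas hold because the kink is a knot, so `G` is a single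
  -- cubic on each knot interval.
  · have h : (fun m : Fin n => max (θ ((m : ℕ) + 2) - θ (l s)) 0) ᵥ*
        (gram θ a b n * (D2 θ n).transpose * (D3 θ n).transpose) = collocA θ a b n l s := by
      ext k
      rw [vecMul_gram_mul_transpose hθ (fun j => max (θ j - θ (l s)) 0)
        (fun t => max (t - θ (l s)) 0 ^ 3), collocA, Matrix.of_apply,
        bspline_eq_of_mem_Ioo hθ (by omega) (by omega) (by omega) (hθ.mem_Ioo hl3 hln)]
      · intro j h1 h2
        have hd := hθ.strict j h1 h2
        rw [deriv_truncCube]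
        rcases hle j h1 h2 with h | h
        · rw [max_eq_right (by linarith), max_eq_right (by linarith)]; ring
        · rw [max_eq_left (by linarith), max_eq_left (by linarith)]; ring
      · intro j h1 h2
        have hd := hθ.strict j h1 h2
        rw [deriv_truncCube]
        rcases hle j h1 h2 with h | h
        · rw [max_eq_right (by linarith), max_eq_right (by linarith)]; ring
        · rw [max_eq_left (by linarith), max_eq_left (by linarith)]; ring
    rw [h, ← Matrix.mul_apply_eq_vecMul, hU]
    ext m
    have hm := m.2
    have hd1 := hθ.strict (m + 2) (by omega) (by omega)
    have hd2 := hθ.strict (m + 3) (by omega) (by omega)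
    rw [vecMul_Z hθ (fun j => max (θ j - θ (l s)) 0), rhsB, Matrix.of_apply]
    simp only [add_assoc, Nat.reduceAdd] at hd1 hd2
    -- Column `m` sees only the knots `m + 2, m + 3, m + 4`; the data there are linear unless the
    -- middle one is `θ_ℓ`, where the slope jumps by 1.
    rcases (by omega : m + 3 < l s ∨ m + 3 = l s ∨ l s < m + 3) with h | h | h
    · have h4 : θ (m + 4) ≤ θ (l s) := hθ.le_of_le (by omega) (by omega) (by omega)
      rw [if_neg (by omega), max_eq_right (by linarith), max_eq_right (by linarith),
        max_eq_right (by linarith)]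
      ring
    · rw [if_pos (by omega), kappa, ← h, max_eq_right (by linarith), max_eq_left (by linarith),
        max_eq_left (by linarith)]
      simp only [show (m : ℕ) + 3 - 1 = m + 2 by omega, show (m : ℕ) + 3 + 1 = m + 4 by omega]
      ring
    · have h4 : θ (l s) ≤ θ (m + 2) := hθ.le_of_le (by omega) (by omega) (by omega)
      rw [if_neg (by omega), max_eq_left (by linarith), max_eq_left (by linarith),
        max_eq_left (by linarith)]
      ring

end LinearSpline
end

open LinearSpline in
theorem mainTheorem7 (n : ℕ) (θ : ℕ → ℝ) (a b : ℝ) (hθ : IsOpenKnotVector n θ a b) :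
    1 - gram θ a b n * S θ n = Z θ n * D3 θ n * D2 θ n ∧
    ∀ (r : ℕ) (l : Fin r → ℕ), StrictMono l → (∀ j, 3 ≤ l j ∧ l j ≤ n) →
      ∀ U : Matrix (Fin (n - 2)) (Fin (n - 2)) ℝ, collocA θ a b n l * U = rhsB θ n l →
        (∀ p : Polynomial ℝ, p.natDegree ≤ 1 →
          Reproduces a b (kernelL θ a b n U) (fun x => p.eval x)) ∧
        ∀ j, Reproduces a b (kernelL θ a b n U) (fun x => max (θ (l j) - x) 0) := by
  refine ⟨one_sub_gram_mul_S hθ, fun r l _ hl U hU => ⟨fun p hp => ?_, fun j => ?_⟩⟩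
  · convert ((reproduces_one hθ U).const_mul (p.coeff 0)).add
      ((reproduces_id hθ U).const_mul (p.coeff 1)) using 2 with x
    conv_lhs => rw [Polynomial.eq_X_add_C_of_natDegree_le_one hp]
    simp
    ring
  -- `(θ_ℓ - x)_+ = θ_ℓ - x + (x - θ_ℓ)_+`.
  · convert (((reproduces_one hθ U).const_mul (θ (l j))).add
      ((reproduces_id hθ U).const_mul (-1))).add (reproduces_truncPow hθ hl hU j) using 2 with x
    rcases le_total (θ (l j)) x with h | h
    · rw [max_eq_right (by linarith), max_eq_left (by linarith)]; ring
    · rw [max_eq_left (by linarith), max_eq_right (by linarith)]; ring
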